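/- Let $n,s,t$ be integers with $n\ge 10$, $s,t\ge 2$ and $n-1\ge s+t$. For elements $x,y$ of a group write $[x,y]=x^{-1}y^{-1}xy$. Let $H$ be the group generated by $\rho_0,\rho_1,\rho_2$ subject to the defining relations $$\rho_0^2=\rho_1^2=\rho_2^2=(\rho_0\rho_1)^{2^s}=(\rho_1\rho_2)^{2^t}=(\rho_0\rho_2)^2=[(\rho_0\rho_1)^4,\rho_2]=[\rho_0,(\rho_1\rho_2)^4]=1$$ together with the relation $$[(\rho_0\rho_1)^2,\rho_2]^{2^{(n-s-t-1)/2}}=1\quad\text{if } n-s-t \text{ is odd},\qquad [(\rho_0\rho_1)^2,(\rho_1\rho_2)^2]^{2^{(n-s-t-2)/2}}=1\quad\text{if } n-s-t\text{ is even}.$$ Then $(H,\{\rho_0,\rho_1,\rho_2\})$ is a string C-group of rank $3$, of order $|H|=2^n$ and of Schläfli type $\{2^s,2^t\}$. In particular, there exists a string C-group of order $2^n$ with Schläfli type $\{2^s,2^t\}$. Here a group $G$ with generators $\rho_0,\dots,\rho_{d-1}$ is a string C-group of rank $d$ if each $\rho_i$ has order exactly $2$, $\rho_i$ and $\rho_j$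 commute whenever $|i-j|>1$, and $G_I\cap G_J=G_{I\cap J}$ for all $I,J\subseteq\{0,\dots,d-1\}$, where $G_I=\langle\rho_i : i\in I\rangle$. Its order is $|G|$, and its Schläfli type is $\{p_1,\dots,p_{d-1}\}$, where $p_i$ is the order of $\rho_{i-1}\rho_i$. -/

import Mathlib

namespace StringC

/-- The pair `(G, {ρ 0, …, ρ (d-1)})` is a string C-group of rank `d`. -/
structure IsStringCGroup {G : Type*} [Group G] {d : ℕ} (ρ : Fin d → G) : Prop where
  /-- every `ρ i` is an involution -/
  involution : ∀ i, orderOf (ρ i) = 2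
  /-- the `ρ i` generate `G` -/
  generates : Subgroup.closure (Set.range ρ) = ⊤
  /-- string property: generators whose indices differ by more than one commute -/
  string : ∀ i j : Fin d, (i : ℕ) + 1 < (j : ℕ) → Commute (ρ i) (ρ j)
  /-- intersection property -/
  intersection : ∀ I J : Set (Fin d),
    Subgroup.closure (ρ '' I) ⊓ Subgroup.closure (ρ '' J) = Subgroup.closure (ρ '' (I ∩ J))

/-- `(G, {ρ 0, …, ρ d})` has Schläfli type `{p 0, …, p (d-1)}`: the order of
`ρ i * ρ (i+1)` is `p i`. -/
def HasSchlafliType {G : Type*} [Group G] {d : ℕ} (ρ : Fin (d + 1) → G) (p : Fin d → ℕ) : Prop :=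
  ∀ i : Fin d, orderOf (ρ i.castSucc * ρ i.succ) = p i

/-- The commutator `[x, y] = x⁻¹ y⁻¹ x y` (Mathlib's `⁅x, y⁆` is `x y x⁻¹ y⁻¹`). -/
def comm {G : Type*} [Group G] (x y : G) : G := x⁻¹ * y⁻¹ * x * y

/-- The relators common to both parities, for `r₀, r₁, r₂` in a group. -/
def baseRelators {G : Type*} [Group G] (s t : ℕ) (r₀ r₁ r₂ : G) : Set G :=
  {r₀ ^ 2, r₁ ^ 2, r₂ ^ 2, (r₀ * r₁) ^ 2 ^ s, (r₁ * r₂) ^ 2 ^ t, (r₀ * r₂) ^ 2,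
    comm ((r₀ * r₁) ^ 4) r₂, comm r₀ ((r₁ * r₂) ^ 4)}

/-- The additional relator, which depends on the parity of `n - s - t`. It is used only for
`n - 1 ≥ s + t`, where none of the subtractions truncates and the divisions are exact. -/
def extraRelator {G : Type*} [Group G] (n s t : ℕ) (r₀ r₁ r₂ : G) : G :=
  if Odd (n - s - t) then comm ((r₀ * r₁) ^ 2) r₂ ^ 2 ^ ((n - s - t - 1) / 2)
  else comm ((r₀ * r₁) ^ 2) ((r₁ * r₂) ^ 2) ^ 2 ^ ((n - s - t - 2) / 2)

/-- All relators of `H`, as words in the free group on three generators. -/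
def relators (n s t : ℕ) : Set (FreeGroup (Fin 3)) :=
  insert (extraRelator n s t (FreeGroup.of 0) (FreeGroup.of 1) (FreeGroup.of 2))
    (baseRelators s t (FreeGroup.of 0) (FreeGroup.of 1) (FreeGroup.of 2))

/-- The finitely presented group `H`. -/
abbrev H (n s t : ℕ) : Type := PresentedGroup (relators n s t)

/-- The generators `ρ₀, ρ₁, ρ₂` of `H`. -/
def gen (n s t : ℕ) : Fin 3 → H n s t := fun i => PresentedGroup.of i

end StringC

/-! Put `A = (ρ₀ρ₁)^4` and `B = (ρ₁ρ₂)^4`. They commute, and each generator centralizes or inverts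
each of them, so `N = ⟨A, B⟩` is normal. The quotient `H / N` satisfies the relations of the Coxeter
group `[4, 4]`, the symmetry group of the square tiling, in which the extra relator becomes a
translation: `(0, m)` if `n - s - t` is odd, `(m, m)` if it is even, with `m` a power of two.

Upper bound (`finite_H_of_square_bound`): `|N| ≤ 2^(s-2) * 2^(t-2)`, and a quotient of `[4, 4]` has
at most eight times as many elements as its translation lattice, that is `8m²` or `16m²`.

Lower bound (`le_card_H`): the wreath product of a dihedral group by `C₂`, or its quotient by a
central involution, realizes these two quotients of `[4, 4]`, and the kernel of the map onto it
contains `⟨A⟩ × ⟨B⟩`.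

The relators survive when any set of generators is sent to 1. The resulting retractions give the
intersection property (`gen_intersection`) and `⟨A⟩ ∩ ⟨B⟩ = 1`; dihedral images give the Schläfli
type. -/

namespace StringC

/-! ### Subgroups generated by two commuting elements; involutions. -/

section GroupLemmas

variable {G : Type*} [Group G]

/-- The subgroup `{u ^ i * v ^ j}` generated by two commuting elements. -/
def commPair (u v : G) (h : Commute u v) : Subgroup G where
  carrier := {x | ∃ i j : ℤ, x = u ^ i * v ^ j}
  one_mem' := ⟨0, 0, by simp⟩
  mul_mem' := by
    rintro _ _ ⟨i, j, rfl⟩ ⟨k, l, rfl⟩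
    refine ⟨i + k, j + l, ?_⟩
    rw [zpow_add, zpow_add, (h.zpow_zpow k j).symm.mul_mul_mul_comm]
  inv_mem' := by
    rintro _ ⟨i, j, rfl⟩
    refine ⟨-i, -j, ?_⟩
    rw [mul_inv_rev, zpow_neg, zpow_neg, ← mul_inv_rev, ← mul_inv_rev, (h.zpow_zpow i j).eq]

lemma left_mem_commPair {u v : G} (h : Commute u v) : u ∈ commPair u v h := ⟨1, 0, by simp⟩

lemma right_mem_commPair {u v : G} (h : Commute u v) : v ∈ commPair u v h := ⟨0, 1, by simp⟩

/-- If `u ^ a = 1` and `v ^ b ∈ ⟨u⟩`, there are at most `a * b` elements `u ^ i * v ^ j`. -/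
lemma finite_zpow_mul_zpow {u v : G} {a b : ℕ} (ha : 0 < a) (hb : 0 < b) (hu : u ^ a = 1)
    (hv : v ^ b ∈ Subgroup.zpowers u) :
    {x : G | ∃ i j : ℤ, x = u ^ i * v ^ j}.Finite ∧
      {x : G | ∃ i j : ℤ, x = u ^ i * v ^ j}.ncard ≤ a * b := by
  classical
  have key : {x : G | ∃ i j : ℤ, x = u ^ i * v ^ j} ⊆
      (fun p : ℕ × ℕ => u ^ p.1 * v ^ p.2) '' ↑(Finset.range a ×ˢ Finset.range b) := by
    rintro _ ⟨i, j, rfl⟩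
    obtain ⟨c, hc⟩ := hv
    -- Divide `j` by `b` and absorb the multiple of `b` into a power of `u`.
    have hj : v ^ j = u ^ (c * (j / b)) * v ^ (j % b) := by
      rw [zpow_mul, show u ^ c = v ^ b from hc, ← zpow_natCast, ← zpow_mul, ← zpow_add,
        Int.mul_ediv_add_emod]
    have ha' : (0 : ℤ) < a := by exact_mod_cast ha
    have hb' : (0 : ℤ) < b := by exact_mod_cast hb
    have hu' (k : ℤ) : u ^ k = u ^ (k % a) := by
      conv_lhs => rw [← Int.mul_ediv_add_emod k a, zpow_add, zpow_mul, zpow_natCast, hu, one_zpow,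
        one_mul]
    refine ⟨(((i + c * (j / b)) % a).toNat, (j % b).toNat), ?_, ?_⟩
    · have h1 := Int.emod_nonneg (i + c * (j / b)) ha'.ne'
      have h2 := Int.emod_lt_of_pos (i + c * (j / b)) ha'
      have h3 := Int.emod_nonneg j hb'.ne'
      have h4 := Int.emod_lt_of_pos j hb'
      simp only [Finset.coe_product, Finset.coe_range, Set.mem_prod, Set.mem_Iio]
      omega
    · simp only
      rw [← zpow_natCast, ← zpow_natCast, Int.toNat_of_nonneg (Int.emod_nonneg _ ha'.ne'),
        Int.toNat_of_nonneg (Int.emod_nonneg _ hb'.ne'), ← hu', hj, ← mul_assoc, ← zpow_add]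
  rw [← Finset.coe_image] at key
  refine ⟨(Finset.finite_toSet _).subset key, (Set.ncard_le_ncard key).trans ?_⟩
  rw [Set.ncard_coe_finset]
  exact Finset.card_image_le.trans (by simp)

lemma commPair_finite {u v : G} (h : Commute u v) {a b : ℕ} (ha : 0 < a) (hb : 0 < b)
    (hu : u ^ a = 1) (hv : v ^ b ∈ Subgroup.zpowers u) :
    Finite (commPair u v h) ∧ Nat.card (commPair u v h) ≤ a * b := by
  obtain ⟨h1, h2⟩ := finite_zpow_mul_zpow ha hb hu hv
  exact ⟨h1, h2⟩

/-- A subgroup `{u ^ i * v ^ j}` is normal as soon as a generating set of involutions conjugates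
`u` and `v` into it. -/
lemma commPair_normal {u v : G} (h : Commute u v) {S : Set G} (hS : Subgroup.closure S = ⊤)
    (hinv : ∀ g ∈ S, g * g = 1) (hu : ∀ g ∈ S, g * u * g⁻¹ ∈ commPair u v h)
    (hv : ∀ g ∈ S, g * v * g⁻¹ ∈ commPair u v h) : (commPair u v h).Normal := by
  have key : ∀ g ∈ S, ∀ x ∈ commPair u v h, g * x * g⁻¹ ∈ commPair u v h := by
    rintro g hg _ ⟨i, j, rfl⟩
    rw [← conj_mul, ← conj_zpow, ← conj_zpow]
    exact mul_mem (zpow_mem (hu g hg) i) (zpow_mem (hv g hg) j)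
  rw [← Subgroup.normalizer_eq_top_iff, eq_top_iff, ← hS, Subgroup.closure_le]
  intro g hg
  have hgi : g⁻¹ = g := inv_eq_of_mul_eq_one_left (hinv g hg)
  refine Subgroup.mem_normalizer_iff.2 fun x => ⟨key g hg x, fun hx => ?_⟩
  have := key g hg _ hx
  rw [hgi] at this
  have e : g * (g * x * g) * g = (g * g) * x * (g * g) := by group
  rwa [e, hinv g hg, one_mul, mul_one] at this

/-- Conjugation by the first of two involutions inverts the powers of their product. -/
lemma conj_left_mul_pow {a b : G} (ha : a * a = 1) (hb : b * b = 1) (k : ℕ) :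
    a * (a * b) ^ k * a⁻¹ = ((a * b) ^ k)⁻¹ := by
  have ha' : a⁻¹ = a := inv_eq_of_mul_eq_one_left ha
  have hb' : b⁻¹ = b := inv_eq_of_mul_eq_one_left hb
  rw [← conj_pow, ← inv_pow, mul_inv_rev, ha', hb', ← mul_assoc a a b, ha, one_mul]

lemma conj_right_mul_pow {a b : G} (ha : a * a = 1) (hb : b * b = 1) (k : ℕ) :
    b * (a * b) ^ k * b⁻¹ = ((a * b) ^ k)⁻¹ := by
  have ha' : a⁻¹ = a := inv_eq_of_mul_eq_one_left ha
  have hb' : b⁻¹ = b := inv_eq_of_mul_eq_one_left hb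
  rw [← conj_pow, ← inv_pow, mul_inv_rev, ha', hb', mul_assoc b (a * b) b, mul_assoc a b b, hb,
    mul_one]

lemma comm_eq_one_iff {x y : G} : comm x y = 1 ↔ Commute x y := by
  rw [comm, mul_assoc, ← mul_inv_rev, inv_mul_eq_one, eq_comm]
  exact Iff.rfl

lemma map_comm {K : Type*} [Group K] (f : G →* K) (x y : G) : f (comm x y) = comm (f x) (f y) := by
  simp [comm]

end GroupLemmas

/-! ### The group `[4, 4]`: translations and bounds for its quotients. -/

/-- The relations of the Coxeter group `[4, 4]`. -/
structure SquareRelations {G : Type*} [Group G] (r₀ r₁ r₂ : G) : Prop where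
  mul_self₀ : r₀ * r₀ = 1
  mul_self₁ : r₁ * r₁ = 1
  mul_self₂ : r₂ * r₂ = 1
  commute₀₂ : Commute r₀ r₂
  pow₀₁ : (r₀ * r₁) ^ 4 = 1
  pow₁₂ : (r₁ * r₂) ^ 4 = 1

namespace SquareRelations

variable {G : Type*} [Group G] {r₀ r₁ r₂ : G}

lemma inv₀ (h : SquareRelations r₀ r₁ r₂) : r₀⁻¹ = r₀ := inv_eq_of_mul_eq_one_left h.mul_self₀

lemma inv₁ (h : SquareRelations r₀ r₁ r₂) : r₁⁻¹ = r₁ := inv_eq_of_mul_eq_one_left h.mul_self₁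

lemma inv₂ (h : SquareRelations r₀ r₁ r₂) : r₂⁻¹ = r₂ := inv_eq_of_mul_eq_one_left h.mul_self₂

lemma commute_conj₀ (h : SquareRelations r₀ r₁ r₂) : Commute r₀ (r₁ * r₀ * r₁) := by
  -- `(r₀ * r₁) ^ 2` equals its own inverse; written out, this is the commutation.
  have e : (r₀ * r₁) ^ 2 * (r₀ * r₁) ^ 2 = 1 := by rw [← pow_add]; exact h.pow₀₁
  have := eq_inv_of_mul_eq_one_left e
  simpa [pow_two, h.inv₀, h.inv₁, mul_assoc, Commute, SemiconjBy] using this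

lemma commute_conj₂ (h : SquareRelations r₀ r₁ r₂) : Commute (r₁ * r₂ * r₁) r₂ := by
  have e : (r₁ * r₂) ^ 2 * (r₁ * r₂) ^ 2 = 1 := by rw [← pow_add]; exact h.pow₁₂
  have := eq_inv_of_mul_eq_one_left e
  simpa [pow_two, h.inv₂, h.inv₁, mul_assoc, Commute, SemiconjBy] using this

lemma commute_conj_conj (h : SquareRelations r₀ r₁ r₂) :
    Commute (r₁ * r₂ * r₁) (r₁ * r₀ * r₁) := by
  have := h.commute₀₂.symm.conj r₁
  rwa [h.inv₁] at this

lemma map {K : Type*} [Group K] (h : SquareRelations r₀ r₁ r₂) (f : G →* K) :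
    SquareRelations (f r₀) (f r₁) (f r₂) where
  mul_self₀ := by rw [← map_mul, h.mul_self₀, map_one]
  mul_self₁ := by rw [← map_mul, h.mul_self₁, map_one]
  mul_self₂ := by rw [← map_mul, h.mul_self₂, map_one]
  commute₀₂ := h.commute₀₂.map f
  pow₀₁ := by rw [← map_mul, ← map_pow, h.pow₀₁, map_one]
  pow₁₂ := by rw [← map_mul, ← map_pow, h.pow₁₂, map_one]

/-- The unit translation along the first axis. -/
def trX (r₀ r₁ r₂ : G) : G := r₀ * (r₁ * r₂ * r₁)

/-- The unit translation along the second axis. -/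
def trY (r₀ r₁ r₂ : G) : G := r₁ * r₀ * r₁ * r₂

lemma commute_tr (h : SquareRelations r₀ r₁ r₂) : Commute (trX r₀ r₁ r₂) (trY r₀ r₁ r₂) :=
  (h.commute_conj₀.mul_right h.commute₀₂).mul_left (h.commute_conj_conj.mul_right h.commute_conj₂)

lemma conj₀_trX (h : SquareRelations r₀ r₁ r₂) :
    r₀ * trX r₀ r₁ r₂ * r₀⁻¹ = (trX r₀ r₁ r₂)⁻¹ := by
  simp [trX, h.inv₀, h.inv₁, h.inv₂, mul_assoc, ← mul_assoc r₀ r₀, h.mul_self₀]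

lemma conj₀_trY (h : SquareRelations r₀ r₁ r₂) : r₀ * trY r₀ r₁ r₂ * r₀⁻¹ = trY r₀ r₁ r₂ := by
  rw [mul_inv_eq_iff_eq_mul]
  exact h.commute_conj₀.mul_right h.commute₀₂

lemma conj₁_trX (h : SquareRelations r₀ r₁ r₂) : r₁ * trX r₀ r₁ r₂ * r₁⁻¹ = trY r₀ r₁ r₂ := by
  simp [trX, trY, h.inv₁, mul_assoc, h.mul_self₁]

lemma conj₁_trY (h : SquareRelations r₀ r₁ r₂) : r₁ * trY r₀ r₁ r₂ * r₁⁻¹ = trX r₀ r₁ r₂ := by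
  simp [trX, trY, h.inv₁, mul_assoc, ← mul_assoc r₁ r₁, h.mul_self₁]

lemma conj₂_trX (h : SquareRelations r₀ r₁ r₂) : r₂ * trX r₀ r₁ r₂ * r₂⁻¹ = trX r₀ r₁ r₂ := by
  rw [mul_inv_eq_iff_eq_mul]
  exact h.commute₀₂.symm.mul_right h.commute_conj₂.symm

lemma conj₂_trY (h : SquareRelations r₀ r₁ r₂) :
    r₂ * trY r₀ r₁ r₂ * r₂⁻¹ = (trY r₀ r₁ r₂)⁻¹ := by
  simp [trY, h.inv₀, h.inv₁, h.inv₂, mul_assoc, h.mul_self₂]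

/-- Turns the odd extra relator into a power of one translation: `r₀` commutes with `r₂` and cancels
from the middle of the word. -/
lemma comm_sq_right (h : SquareRelations r₀ r₁ r₂) :
    comm ((r₀ * r₁) ^ 2) r₂ = trY r₀ r₁ r₂ ^ 2 := by
  have e : r₀ * (r₂ * r₀) = r₂ := by
    rw [← h.commute₀₂.eq, ← mul_assoc, h.mul_self₀, one_mul]
  simp only [comm, trY, pow_two, mul_inv_rev, h.inv₀, h.inv₁, h.inv₂, mul_assoc]
  rw [← mul_assoc r₂ r₀, ← mul_assoc r₀ (r₂ * r₀), e]

/-- Both squares are involutions, so their commutator is the square of their product, which is the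
diagonal translation. -/
lemma comm_sq_sq (h : SquareRelations r₀ r₁ r₂) :
    comm ((r₀ * r₁) ^ 2) ((r₁ * r₂) ^ 2) = trX r₀ r₁ r₂ ^ 2 * trY r₀ r₁ r₂ ^ 2 := by
  have e1 : (r₀ * r₁) ^ 2 = r₀ * (r₁ * r₀ * r₁) := by simp [pow_two, mul_assoc]
  have e2 : (r₁ * r₂) ^ 2 = r₁ * r₂ * r₁ * r₂ := by simp [pow_two, mul_assoc]
  have i1 : ((r₀ * r₁) ^ 2)⁻¹ = (r₀ * r₁) ^ 2 := by
    rw [inv_eq_iff_mul_eq_one, ← pow_add]; exact h.pow₀₁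
  have i2 : ((r₁ * r₂) ^ 2)⁻¹ = (r₁ * r₂) ^ 2 := by
    rw [inv_eq_iff_mul_eq_one, ← pow_add]; exact h.pow₁₂
  have e3 : (r₀ * r₁) ^ 2 * (r₁ * r₂) ^ 2 = trX r₀ r₁ r₂ * trY r₀ r₁ r₂ := by
    rw [e1, e2, trX, trY, h.commute_conj_conj.symm.mul_mul_mul_comm]
  rw [comm, i1, i2, mul_assoc, e3, ← h.commute_tr.mul_pow, pow_two]

open scoped Pointwise in
/-- If `r₀, r₁, r₂` generate the group, and the translation lattice `⟨u, v⟩` satisfies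
`u ^ a = 1` and `v ^ b ∈ ⟨u⟩`, then the group has at most `8 * a * b` elements. -/
lemma finite (h : SquareRelations r₀ r₁ r₂) (hgen : Subgroup.closure {r₀, r₁, r₂} = ⊤) {a b : ℕ}
    (ha : 0 < a) (hb : 0 < b) (hu : trX r₀ r₁ r₂ ^ a = 1)
    (hv : trY r₀ r₁ r₂ ^ b ∈ Subgroup.zpowers (trX r₀ r₁ r₂)) :
    Finite G ∧ Nat.card G ≤ 8 * (a * b) := by
  set M := commPair _ _ h.commute_tr with hM
  have huM : trX r₀ r₁ r₂ ∈ M := left_mem_commPair _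
  have hvM : trY r₀ r₁ r₂ ∈ M := right_mem_commPair _
  obtain ⟨hMf, hMc⟩ := commPair_finite h.commute_tr ha hb hu hv
  have hMn : M.Normal := by
    refine commPair_normal h.commute_tr hgen ?_ ?_ ?_
    · rintro g (rfl | rfl | rfl)
      exacts [h.mul_self₀, h.mul_self₁, h.mul_self₂]
    · rintro g (rfl | rfl | rfl)
      · rw [h.conj₀_trX]; exact inv_mem huM
      · rw [h.conj₁_trX]; exact hvM
      · rw [h.conj₂_trX]; exact huM
    · rintro g (rfl | rfl | rfl)
      · rw [h.conj₀_trY]; exact hvM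
      · rw [h.conj₁_trY]; exact huM
      · rw [h.conj₂_trY]; exact inv_mem hvM
  -- The point group `⟨r₁, r₂⟩`, dihedral of order at most 8; the plan is `G = M * K`.
  set K : Set G := {x | ∃ i j : ℤ, x = (r₁ * r₂) ^ i * r₁ ^ j} with hK
  obtain ⟨hKf, hKc⟩ : K.Finite ∧ K.ncard ≤ 4 * 2 :=
    finite_zpow_mul_zpow (by norm_num) (by norm_num) h.pow₁₂
      (by rw [pow_two, h.mul_self₁]; exact one_mem _)
  have hK₁ : ∀ x ∈ K, x * r₁ ∈ K := by
    rintro _ ⟨i, j, rfl⟩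
    exact ⟨i, j + 1, by rw [zpow_add_one, mul_assoc]⟩
  have hK₂ : ∀ x ∈ K, x * r₂ ∈ K := by
    rintro _ ⟨i, j, rfl⟩
    have hj : r₁ ^ j = 1 ∨ r₁ ^ j = r₁ := by
      have h2 : r₁ ^ (2 : ℤ) = 1 := by rw [zpow_two, h.mul_self₁]
      obtain ⟨k, rfl | rfl⟩ := Int.even_or_odd' j
      · left; rw [zpow_mul, h2, one_zpow]
      · right; rw [zpow_add, zpow_mul, h2, one_zpow, one_mul, zpow_one]
    rcases hj with hj | hj
    · refine ⟨i - 1, 1, ?_⟩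
      rw [hj, zpow_sub_one, mul_inv_rev, h.inv₁, h.inv₂, zpow_one, mul_one, mul_assoc, mul_assoc,
        h.mul_self₁, mul_one]
    · refine ⟨i + 1, 0, ?_⟩
      rw [hj, zpow_add_one, zpow_zero, mul_one, mul_assoc]
  -- Modulo translations `r₀` is the parallel reflection `r₁ * r₂ * r₁`, which lies in the point
  -- group.
  have hr₀ : r₀ = trX r₀ r₁ r₂ * (r₁ * r₂ * r₁) := by
    rw [trX, mul_assoc, ← mul_assoc (r₁ * r₂ * r₁)]
    simp [mul_assoc, ← mul_assoc r₁ r₁, h.mul_self₁, h.mul_self₂]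
  have hK₀ : ∀ m ∈ M, ∀ k ∈ K, ∃ m' ∈ M, ∃ k' ∈ K, m * k * r₀ = m' * k' := by
    intro m hm k hk
    refine ⟨m * (k * trX r₀ r₁ r₂ * k⁻¹), mul_mem hm (hMn.conj_mem _ huM k),
      k * r₁ * r₂ * r₁, hK₁ _ (hK₂ _ (hK₁ _ hk)), ?_⟩
    conv_lhs => rw [hr₀]
    group
  have huniv : (M : Set G) * K = Set.univ := by
    have hinv : ∀ g ∈ ({r₀, r₁, r₂} : Set G), g⁻¹ = g := by
      rintro g (rfl | rfl | rfl)
      exacts [h.inv₀, h.inv₁, h.inv₂]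
    have step : ∀ x ∈ (M : Set G) * K, ∀ g ∈ ({r₀, r₁, r₂} : Set G),
        x * g ∈ (M : Set G) * K := by
      rintro _ ⟨m, hm, k, hk, rfl⟩ g (rfl | rfl | rfl)
      · obtain ⟨m', hm', k', hk', e⟩ := hK₀ m hm k hk
        exact ⟨m', hm', k', hk', e.symm⟩
      · exact ⟨m, hm, _, hK₁ k hk, (mul_assoc _ _ _).symm⟩
      · exact ⟨m, hm, _, hK₂ k hk, (mul_assoc _ _ _).symm⟩
    refine Set.eq_univ_of_forall fun x => ?_
    have hx : x ∈ Subgroup.closure {r₀, r₁, r₂} := hgen ▸ Subgroup.mem_top x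
    induction hx using Subgroup.closure_induction_right with
    | one => exact ⟨1, one_mem _, 1, ⟨0, 0, by simp⟩, by simp⟩
    | mul_right x _ g hg ih => exact step x ih g hg
    | mul_inv_cancel x _ g hg ih => rw [hinv g hg]; exact step x ih g hg
  have hMfin : (M : Set G).Finite := hMf
  refine ⟨Set.finite_univ_iff.1 (huniv ▸ hMfin.mul hKf), ?_⟩
  rw [← Set.ncard_univ, ← huniv]
  calc ((M : Set G) * K).ncard ≤ (M : Set G).ncard * K.ncard := Set.natCard_mul_le
    _ ≤ (a * b) * (4 * 2) := Nat.mul_le_mul hMc hKc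
    _ = 8 * (a * b) := by ring

lemma finite_of_trY_pow (h : SquareRelations r₀ r₁ r₂)
    (hgen : Subgroup.closure {r₀, r₁, r₂} = ⊤) {m : ℕ} (hm : 0 < m)
    (hv : trY r₀ r₁ r₂ ^ m = 1) : Finite G ∧ Nat.card G ≤ 8 * (m * m) := by
  refine h.finite hgen hm hm ?_ (hv ▸ one_mem _)
  rw [← h.conj₁_trY, conj_pow, hv, mul_one, mul_inv_cancel]

lemma finite_of_trX_pow_mul_trY_pow (h : SquareRelations r₀ r₁ r₂)
    (hgen : Subgroup.closure {r₀, r₁, r₂} = ⊤) {m : ℕ} (hm : 0 < m)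
    (huv : trX r₀ r₁ r₂ ^ m * trY r₀ r₁ r₂ ^ m = 1) :
    Finite G ∧ Nat.card G ≤ 8 * (2 * m * m) := by
  have huv' : (trX r₀ r₁ r₂ ^ m)⁻¹ * trY r₀ r₁ r₂ ^ m = 1 := by
    have : r₀ * (trX r₀ r₁ r₂ ^ m * trY r₀ r₁ r₂ ^ m) * r₀⁻¹ = 1 := by
      rw [huv, mul_one, mul_inv_cancel]
    rwa [← conj_mul, ← conj_pow, ← conj_pow, h.conj₀_trX, h.conj₀_trY, inv_pow] at this
  -- Conjugation by `r₀` has turned `(m, m)` into `(-m, m)`; together they give `(2m, 0)`, whence `a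
  -- = 2 * m` and `b = m`.
  have e : trX r₀ r₁ r₂ ^ m = trY r₀ r₁ r₂ ^ m := inv_mul_eq_one.1 huv'
  refine h.finite hgen (by positivity) hm ?_ (e ▸ Subgroup.npow_mem_zpowers _ m)
  rw [two_mul, pow_add]
  nth_rewrite 2 [e]
  exact huv

end SquareRelations

/-! ### Realizations of the relations and maps out of `H`. -/

section Presentation

variable {G : Type*} [Group G]

lemma map_extraRelator {K : Type*} [Group K] (f : G →* K) (n s t : ℕ) (a b c : G) :
    f (extraRelator n s t a b c) = extraRelator n s t (f a) (f b) (f c) := by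
  unfold extraRelator
  split_ifs <;> simp [map_comm]

lemma extraRelator_odd (s t k : ℕ) (a b c : G) :
    extraRelator (s + t + 1 + 2 * k) s t a b c = comm ((a * b) ^ 2) c ^ 2 ^ k := by
  have e : s + t + 1 + 2 * k - s - t = 2 * k + 1 := by omega
  rw [extraRelator, e, if_pos ⟨k, rfl⟩]
  congr 2
  omega

lemma extraRelator_even (s t k : ℕ) (a b c : G) :
    extraRelator (s + t + 2 + 2 * k) s t a b c =
      comm ((a * b) ^ 2) ((b * c) ^ 2) ^ 2 ^ k := by
  have e : s + t + 2 + 2 * k - s - t = 2 * (k + 1) := by omega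
  rw [extraRelator, e, if_neg (by simp)]
  congr 2
  omega

/-- The elements `r₀, r₁, r₂` satisfy the defining relations of `H n s t`. -/
structure Realizes (n s t : ℕ) (r₀ r₁ r₂ : G) : Prop where
  mul_self₀ : r₀ * r₀ = 1
  mul_self₁ : r₁ * r₁ = 1
  mul_self₂ : r₂ * r₂ = 1
  pow₀₁ : (r₀ * r₁) ^ 2 ^ s = 1
  pow₁₂ : (r₁ * r₂) ^ 2 ^ t = 1
  commute₀₂ : Commute r₀ r₂
  commute_pow₀₁ : Commute ((r₀ * r₁) ^ 4) r₂
  commute_pow₁₂ : Commute r₀ ((r₁ * r₂) ^ 4)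
  extra : extraRelator n s t r₀ r₁ r₂ = 1

lemma mul_sq_eq_one_iff_commute {a b : G} (ha : a * a = 1) (hb : b * b = 1) :
    (a * b) ^ 2 = 1 ↔ Commute a b := by
  rw [pow_two, mul_eq_one_iff_eq_inv, mul_inv_rev, inv_eq_of_mul_eq_one_left ha,
    inv_eq_of_mul_eq_one_left hb]
  exact Iff.rfl

/-- The homomorphism out of `H n s t` determined by a realization of its relations. -/
def Realizes.lift {n s t : ℕ} {r₀ r₁ r₂ : G} (h : Realizes n s t r₀ r₁ r₂) : H n s t →* G :=
  PresentedGroup.toGroup (f := ![r₀, r₁, r₂]) <| by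
    have h02 := (mul_sq_eq_one_iff_commute h.mul_self₀ h.mul_self₂).2 h.commute₀₂
    have h4 := comm_eq_one_iff.2 h.commute_pow₀₁
    have h5 := comm_eq_one_iff.2 h.commute_pow₁₂
    rintro w (rfl | rfl | rfl | rfl | rfl | rfl | rfl | rfl | rfl)
    · rw [map_extraRelator]; simpa using h.extra
    · simpa [pow_two] using h.mul_self₀
    · simpa [pow_two] using h.mul_self₁
    · simpa [pow_two] using h.mul_self₂
    · simpa using h.pow₀₁
    · simpa using h.pow₁₂
    · simpa using h02
    · simpa [map_comm] using h4
    · simpa [map_comm] using h5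

lemma Realizes.lift_gen {n s t : ℕ} {r₀ r₁ r₂ : G} (h : Realizes n s t r₀ r₁ r₂) (i : Fin 3) :
    h.lift (gen n s t i) = ![r₀, r₁, r₂] i :=
  PresentedGroup.toGroup.of _

lemma Realizes.map {K : Type*} [Group K] {n s t : ℕ} {r₀ r₁ r₂ : G} (h : Realizes n s t r₀ r₁ r₂)
    (f : G →* K) : Realizes n s t (f r₀) (f r₁) (f r₂) where
  mul_self₀ := by rw [← map_mul, h.mul_self₀, map_one]
  mul_self₁ := by rw [← map_mul, h.mul_self₁, map_one]
  mul_self₂ := by rw [← map_mul, h.mul_self₂, map_one]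
  pow₀₁ := by rw [← map_mul, ← map_pow, h.pow₀₁, map_one]
  pow₁₂ := by rw [← map_mul, ← map_pow, h.pow₁₂, map_one]
  commute₀₂ := h.commute₀₂.map f
  commute_pow₀₁ := by simpa using h.commute_pow₀₁.map f
  commute_pow₁₂ := by simpa using h.commute_pow₁₂.map f
  extra := by rw [← map_extraRelator, h.extra, map_one]

lemma gen_realizes (n s t : ℕ) : Realizes n s t (gen n s t 0) (gen n s t 1) (gen n s t 2) := by
  have key (w : FreeGroup (Fin 3)) (hw : w ∈ relators n s t) :
      PresentedGroup.mk (relators n s t) w = 1 := PresentedGroup.one_of_mem hw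
  have k0 (w : FreeGroup (Fin 3)) (hw : w ∈ baseRelators s t (FreeGroup.of 0) (FreeGroup.of 1)
      (FreeGroup.of 2)) : PresentedGroup.mk (relators n s t) w = 1 := key w (Or.inr hw)
  simp only [baseRelators, Set.mem_insert_iff, Set.mem_singleton_iff, forall_eq_or_imp, forall_eq,
    map_pow, map_mul, map_comm] at k0
  obtain ⟨h0, h1, h2, h01, h12, h02, h4, h5⟩ := k0
  have hx := key _ (Or.inl rfl)
  rw [map_extraRelator] at hx
  rw [pow_two] at h0 h1 h2
  exact ⟨h0, h1, h2, h01, h12, (mul_sq_eq_one_iff_commute h0 h2).1 h02, comm_eq_one_iff.1 h4,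
    comm_eq_one_iff.1 h5, hx⟩

lemma closure_range_gen (n s t : ℕ) : Subgroup.closure (Set.range (gen n s t)) = ⊤ :=
  PresentedGroup.closure_range_of _

lemma closure_gen (n s t : ℕ) :
    Subgroup.closure {gen n s t 0, gen n s t 1, gen n s t 2} = ⊤ := by
  rw [← closure_range_gen n s t]
  congr 1
  ext x
  simp [Fin.exists_fin_succ, eq_comm]

lemma comm_one_right (x : G) : comm x 1 = 1 := by simp [comm]

lemma comm_one_left (x : G) : comm 1 x = 1 := by simp [comm]

lemma pow_two_pow_eq_one {a : G} (ha : a * a = 1) {k : ℕ} (hk : 1 ≤ k) : a ^ 2 ^ k = 1 := by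
  obtain ⟨k, rfl⟩ := Nat.exists_eq_add_of_le hk
  rw [pow_add, pow_one, pow_mul, pow_two, ha, one_pow]

lemma pow_four_eq_one {a : G} (ha : a * a = 1) : a ^ 4 = 1 :=
  pow_two_pow_eq_one ha (k := 2) (by norm_num)

/-- With one generator sent to 1, the commutator relators vanish and a product of two generators
degenerates to an involution. The next two lemmas treat the other generators. -/
lemma realizes_one_right {n s t : ℕ} (ht : 1 ≤ t) {a b : G} (ha : a * a = 1) (hb : b * b = 1)
    (hab : (a * b) ^ 2 ^ s = 1) : Realizes n s t a b 1 where
  mul_self₀ := ha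
  mul_self₁ := hb
  mul_self₂ := one_mul 1
  pow₀₁ := hab
  pow₁₂ := by rw [mul_one]; exact pow_two_pow_eq_one hb ht
  commute₀₂ := Commute.one_right _
  commute_pow₀₁ := Commute.one_right _
  commute_pow₁₂ := by rw [mul_one, pow_four_eq_one hb]; exact Commute.one_right _
  extra := by
    unfold extraRelator
    split_ifs <;> simp [comm_one_right, pow_two, hb]

lemma realizes_one_left {n s t : ℕ} (hs : 1 ≤ s) {b c : G} (hb : b * b = 1) (hc : c * c = 1)
    (hbc : (b * c) ^ 2 ^ t = 1) : Realizes n s t 1 b c where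
  mul_self₀ := one_mul 1
  mul_self₁ := hb
  mul_self₂ := hc
  pow₀₁ := by rw [one_mul]; exact pow_two_pow_eq_one hb hs
  pow₁₂ := hbc
  commute₀₂ := Commute.one_left _
  commute_pow₀₁ := by rw [one_mul, pow_four_eq_one hb]; exact Commute.one_left _
  commute_pow₁₂ := Commute.one_left _
  extra := by
    unfold extraRelator
    split_ifs <;> simp [comm_one_left, pow_two, hb]

lemma realizes_one_mid {n s t : ℕ} (hs : 1 ≤ s) (ht : 1 ≤ t) {a c : G} (ha : a * a = 1)
    (hc : c * c = 1) (hac : Commute a c) : Realizes n s t a 1 c where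
  mul_self₀ := ha
  mul_self₁ := one_mul 1
  mul_self₂ := hc
  pow₀₁ := by rw [mul_one]; exact pow_two_pow_eq_one ha hs
  pow₁₂ := by rw [one_mul]; exact pow_two_pow_eq_one hc ht
  commute₀₂ := hac
  commute_pow₀₁ := by rw [mul_one, pow_four_eq_one ha]; exact Commute.one_left _
  commute_pow₁₂ := by rw [one_mul, pow_four_eq_one hc]; exact Commute.one_right _
  extra := by
    unfold extraRelator
    split_ifs <;> simp [comm_one_left, pow_two, ha]

lemma SquareRelations.realizes {n s t : ℕ} (hs : 2 ≤ s) (ht : 2 ≤ t) {a b c : G}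
    (h : SquareRelations a b c) (hx : extraRelator n s t a b c = 1) : Realizes n s t a b c where
  mul_self₀ := h.mul_self₀
  mul_self₁ := h.mul_self₁
  mul_self₂ := h.mul_self₂
  pow₀₁ := by
    obtain ⟨k, rfl⟩ := Nat.exists_eq_add_of_le hs
    rw [pow_add, pow_mul]
    exact (congrArg (· ^ 2 ^ k) h.pow₀₁).trans (one_pow _)
  pow₁₂ := by
    obtain ⟨k, rfl⟩ := Nat.exists_eq_add_of_le ht
    rw [pow_add, pow_mul]
    exact (congrArg (· ^ 2 ^ k) h.pow₁₂).trans (one_pow _)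
  commute₀₂ := h.commute₀₂
  commute_pow₀₁ := by rw [h.pow₀₁]; exact Commute.one_left _
  commute_pow₁₂ := by rw [h.pow₁₂]; exact Commute.one_right _
  extra := hx

end Presentation

/-! ### Retractions onto parabolic subgroups; the intersection property. -/

section Retraction

variable {n s t : ℕ}

open scoped Classical in
/-- Killing the generators outside `I` is an endomorphism of `H n s t`. -/
lemma exists_retraction (hs : 1 ≤ s) (ht : 1 ≤ t) (I : Set (Fin 3)) :
    ∃ f : H n s t →* H n s t, ∀ i, f (gen n s t i) = if i ∈ I then gen n s t i else 1 := by
  have h := gen_realizes n s t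
  suffices hR : Realizes n s t (if 0 ∈ I then gen n s t 0 else 1)
      (if 1 ∈ I then gen n s t 1 else 1) (if 2 ∈ I then gen n s t 2 else 1) by
    refine ⟨hR.lift, fun i => ?_⟩
    rw [hR.lift_gen]
    fin_cases i <;> rfl
  have hite {x : H n s t} (hx : x * x = 1) (i : Fin 3) :
      (if i ∈ I then x else 1) * (if i ∈ I then x else 1) = 1 := by
    split_ifs <;> simp [hx]
  have hc : Commute (if 0 ∈ I then gen n s t 0 else 1) (if 2 ∈ I then gen n s t 2 else 1) := by
    split_ifs <;> simp [h.commute₀₂]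
  by_cases h1 : (1 : Fin 3) ∈ I
  swap
  · rw [if_neg h1]
    exact realizes_one_mid hs ht (hite h.mul_self₀ 0) (hite h.mul_self₂ 2) hc
  by_cases h0 : (0 : Fin 3) ∈ I
  swap
  · rw [if_neg h0]
    refine realizes_one_left hs (hite h.mul_self₁ 1) (hite h.mul_self₂ 2) ?_
    rw [if_pos h1]
    split_ifs
    · exact h.pow₁₂
    · rw [mul_one]; exact pow_two_pow_eq_one h.mul_self₁ ht
  by_cases h2 : (2 : Fin 3) ∈ I
  swap
  · rw [if_neg h2, if_pos h0, if_pos h1]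
    exact realizes_one_right ht h.mul_self₀ h.mul_self₁ h.pow₀₁
  rwa [if_pos h0, if_pos h1, if_pos h2]

lemma gen_intersection (hs : 1 ≤ s) (ht : 1 ≤ t) (I J : Set (Fin 3)) :
    Subgroup.closure (gen n s t '' I) ⊓ Subgroup.closure (gen n s t '' J) =
      Subgroup.closure (gen n s t '' (I ∩ J)) := by
  classical
  refine le_antisymm ?_ (le_inf (Subgroup.closure_mono (Set.image_mono Set.inter_subset_left))
    (Subgroup.closure_mono (Set.image_mono Set.inter_subset_right)))
  obtain ⟨f, hf⟩ := exists_retraction (n := n) hs ht I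
  rintro x ⟨hI, hJ⟩
  have hfix : Set.EqOn f (MonoidHom.id _) (Subgroup.closure (gen n s t '' I)) := by
    refine MonoidHom.eqOn_closure ?_
    rintro _ ⟨i, hi, rfl⟩
    simp [hf, hi]
  have hmap : (Subgroup.closure (gen n s t '' J)).map f ≤
      Subgroup.closure (gen n s t '' (I ∩ J)) := by
    rw [MonoidHom.map_closure, Subgroup.closure_le]
    rintro _ ⟨_, ⟨j, hj, rfl⟩, rfl⟩
    rw [hf]
    split_ifs with hi
    · exact Subgroup.subset_closure ⟨j, ⟨hi, hj⟩, rfl⟩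
    · exact one_mem _
  -- The retraction fixes `x` because `x` lies in the subgroup of `I`, and carries the subgroup of
  -- `J` into that of `I ∩ J`.
  have hx : f x = x := hfix hI
  rw [← hx]
  exact hmap ⟨x, hJ, rfl⟩

end Retraction

/-! ### Orders of generators and of adjacent products, from dihedral images. -/

section Orders

variable {n s t : ℕ}

open DihedralGroup

lemma dihedral_realizes_left (ht : 1 ≤ t) :
    Realizes n s t (sr 0 : DihedralGroup (2 ^ s)) (sr 1) 1 :=
  realizes_one_right ht (sr_mul_self _) (sr_mul_self _) (by simp)

lemma dihedral_realizes_right (hs : 1 ≤ s) :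
    Realizes n s t 1 (sr 0 : DihedralGroup (2 ^ t)) (sr 1) :=
  realizes_one_left hs (sr_mul_self _) (sr_mul_self _) (by simp)

lemma orderOf_gen₀₁ (ht : 1 ≤ t) : orderOf (gen n s t 0 * gen n s t 1) = 2 ^ s := by
  refine Nat.dvd_antisymm (orderOf_dvd_of_pow_eq_one (gen_realizes n s t).pow₀₁) ?_
  have h := orderOf_map_dvd (dihedral_realizes_left (n := n) (s := s) ht).lift
    (gen n s t 0 * gen n s t 1)
  rw [map_mul, Realizes.lift_gen, Realizes.lift_gen] at h
  simpa [sr_mul_sr] using h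

lemma orderOf_gen₁₂ (hs : 1 ≤ s) : orderOf (gen n s t 1 * gen n s t 2) = 2 ^ t := by
  refine Nat.dvd_antisymm (orderOf_dvd_of_pow_eq_one (gen_realizes n s t).pow₁₂) ?_
  have h := orderOf_map_dvd (dihedral_realizes_right (n := n) (t := t) hs).lift
    (gen n s t 1 * gen n s t 2)
  rw [map_mul, Realizes.lift_gen, Realizes.lift_gen] at h
  simpa [sr_mul_sr] using h

lemma orderOf_gen (hs : 1 ≤ s) (ht : 1 ≤ t) (i : Fin 3) : orderOf (gen n s t i) = 2 := by
  have h := gen_realizes n s t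
  have hsr {k : ℕ} (j : ZMod k) : (sr j : DihedralGroup k) ≠ 1 := by
    rw [one_def]; exact fun h => by cases h
  have hL := dihedral_realizes_left (n := n) (s := s) ht
  have hR := dihedral_realizes_right (n := n) (t := t) hs
  refine orderOf_eq_prime ?_ ?_
  · rw [pow_two]
    fin_cases i
    exacts [h.mul_self₀, h.mul_self₁, h.mul_self₂]
  · intro hi
    have e1 := hL.lift_gen i
    have e2 := hR.lift_gen i
    rw [hi, map_one] at e1 e2
    fin_cases i
    exacts [hsr _ e1.symm, hsr _ e1.symm, hsr _ e2.symm]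

end Orders

/-! ### Reduction of `|H|` to quotients of `[4, 4]`. -/

section Cardinality

variable {n s t : ℕ}

lemma orderOf_gen₀₁_pow_four (hs : 2 ≤ s) (ht : 1 ≤ t) :
    orderOf ((gen n s t 0 * gen n s t 1) ^ 4) = 2 ^ (s - 2) := by
  have h4 : (4 : ℕ) = 2 ^ 2 := by norm_num
  rw [orderOf_pow_of_dvd (by norm_num) (by rw [orderOf_gen₀₁ ht, h4]; exact pow_dvd_pow 2 hs),
    orderOf_gen₀₁ ht, h4, Nat.pow_div hs (by norm_num)]

lemma orderOf_gen₁₂_pow_four (hs : 1 ≤ s) (ht : 2 ≤ t) :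
    orderOf ((gen n s t 1 * gen n s t 2) ^ 4) = 2 ^ (t - 2) := by
  have h4 : (4 : ℕ) = 2 ^ 2 := by norm_num
  rw [orderOf_pow_of_dvd (by norm_num) (by rw [orderOf_gen₁₂ hs, h4]; exact pow_dvd_pow 2 ht),
    orderOf_gen₁₂ hs, h4, Nat.pow_div ht (by norm_num)]

/-- The retraction killing `ρ₂` fixes the first fourth power and kills the second. -/
lemma disjoint_zpowers_pow_four (ht : 1 ≤ t) :
    Disjoint (Subgroup.zpowers ((gen n s t 0 * gen n s t 1) ^ 4))
      (Subgroup.zpowers ((gen n s t 1 * gen n s t 2) ^ 4)) := by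
  have h := gen_realizes n s t
  have hf := realizes_one_right (n := n) ht h.mul_self₀ h.mul_self₁ h.pow₀₁
  rw [Subgroup.disjoint_def]
  rintro _ ⟨i, rfl⟩ ⟨j, hj⟩
  have hA : hf.lift ((gen n s t 0 * gen n s t 1) ^ 4) = (gen n s t 0 * gen n s t 1) ^ 4 := by
    rw [map_pow, map_mul, hf.lift_gen, hf.lift_gen]; rfl
  have hB : hf.lift ((gen n s t 1 * gen n s t 2) ^ 4) = 1 := by
    rw [map_pow, map_mul, hf.lift_gen, hf.lift_gen]
    exact (congrArg (· ^ 4) (mul_one _)).trans (pow_four_eq_one h.mul_self₁)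
  have e := congrArg hf.lift hj
  simp only [map_zpow, hA, hB, one_zpow] at e
  exact e.symm

lemma commute_pow_four {G : Type*} [Group G] {r₀ r₁ r₂ : G} (h : Realizes n s t r₀ r₁ r₂) :
    Commute ((r₀ * r₁) ^ 4) ((r₁ * r₂) ^ 4) := by
  have e : (r₁ * r₂) ^ 4 = (r₁ * r₂ * r₁⁻¹ * r₂) ^ 2 := by
    rw [inv_eq_of_mul_eq_one_left h.mul_self₁]
    simp only [pow_succ, pow_zero, one_mul, mul_assoc]
  -- Conjugation by `r₁` inverts `(r₀ * r₁) ^ 4`, so it carries commutation with `r₂` to commutation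
  -- with `r₁ * r₂ * r₁⁻¹`.
  have h1 : Commute ((r₀ * r₁) ^ 4) (r₁ * r₂ * r₁⁻¹) := by
    have := (h.commute_pow₀₁.inv_left).conj r₁
    rwa [← conj_right_mul_pow h.mul_self₀ h.mul_self₁, mul_assoc r₁ (r₁ * _ * _),
      mul_assoc (r₁ * _), ← mul_inv_rev, h.mul_self₁, inv_one, mul_one, ← mul_assoc, h.mul_self₁,
      one_mul] at this
  rw [e]
  exact (h1.mul_right h.commute_pow₀₁).pow_right 2

/-- An upper bound for `H n s t` from one for its quotient by the normal subgroup generated by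
`(ρ₀ρ₁)⁴` and `(ρ₁ρ₂)⁴`, a group satisfying the relations of `[4, 4]`. -/
lemma finite_H_of_square_bound (hs : 2 ≤ s) (ht : 2 ≤ t) {b : ℕ}
    (hb : ∀ (Q : Type) [Group Q] (q₀ q₁ q₂ : Q), SquareRelations q₀ q₁ q₂ →
      Subgroup.closure {q₀, q₁, q₂} = ⊤ → extraRelator n s t q₀ q₁ q₂ = 1 →
      Finite Q ∧ Nat.card Q ≤ b) :
    Finite (H n s t) ∧ Nat.card (H n s t) ≤ 2 ^ (s - 2) * 2 ^ (t - 2) * b := by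
  have h := gen_realizes n s t
  have hc := commute_pow_four h
  have hA : (gen n s t 0 * gen n s t 1) ^ 4 ∈ commPair _ _ hc := left_mem_commPair hc
  have hB : (gen n s t 1 * gen n s t 2) ^ 4 ∈ commPair _ _ hc := right_mem_commPair hc
  have hN : (commPair _ _ hc).Normal := by
    refine commPair_normal hc (closure_gen n s t) ?_ ?_ ?_
    · rintro g (rfl | rfl | rfl)
      exacts [h.mul_self₀, h.mul_self₁, h.mul_self₂]
    · rintro g (rfl | rfl | rfl)
      · rw [conj_left_mul_pow h.mul_self₀ h.mul_self₁]; exact inv_mem hA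
      · rw [conj_right_mul_pow h.mul_self₀ h.mul_self₁]; exact inv_mem hA
      · rw [h.commute_pow₀₁.symm.eq, mul_inv_cancel_right]; exact hA
    · rintro g (rfl | rfl | rfl)
      · rw [h.commute_pow₁₂.eq, mul_inv_cancel_right]; exact hB
      · rw [conj_left_mul_pow h.mul_self₁ h.mul_self₂]; exact inv_mem hB
      · rw [conj_right_mul_pow h.mul_self₁ h.mul_self₂]; exact inv_mem hB
  obtain ⟨hNf, hNc⟩ := commPair_finite hc (a := 2 ^ (s - 2)) (b := 2 ^ (t - 2)) (by positivity)
    (by positivity)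
    (by rw [← orderOf_gen₀₁_pow_four (n := n) hs (by omega : 1 ≤ t), pow_orderOf_eq_one])
    (by
      rw [← orderOf_gen₁₂_pow_four (n := n) (by omega : 1 ≤ s) ht, pow_orderOf_eq_one]
      exact one_mem _)
  set N := commPair _ _ hc
  have hq := h.map (QuotientGroup.mk' N)
  obtain ⟨hQf, hQc⟩ := hb (H n s t ⧸ N) _ _ _
    ⟨hq.mul_self₀, hq.mul_self₁, hq.mul_self₂, hq.commute₀₂,
      by rw [← map_mul, ← map_pow]; exact (QuotientGroup.eq_one_iff _).2 hA,
      by rw [← map_mul, ← map_pow]; exact (QuotientGroup.eq_one_iff _).2 hB⟩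
    (by
      have := congrArg (Subgroup.map (QuotientGroup.mk' N)) (closure_gen n s t)
      rwa [MonoidHom.map_closure, Set.image_insert_eq, Set.image_pair,
        Subgroup.map_top_of_surjective _ (QuotientGroup.mk'_surjective N)] at this)
    hq.extra
  refine ⟨Finite.of_equiv _ (Subgroup.groupEquivQuotientProdSubgroup (s := N)).symm, ?_⟩
  rw [Subgroup.card_eq_card_quotient_mul_card_subgroup N, mul_comm]
  exact Nat.mul_le_mul hNc hQc

/-- A group generated by a realization of the relations of `H n s t` and of `[4, 4]` bounds the
order of `H n s t` from below. -/
lemma le_card_H [Finite (H n s t)] (hs : 2 ≤ s) (ht : 2 ≤ t) {Q : Type*} [Group Q]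
    {q₀ q₁ q₂ : Q} (h : SquareRelations q₀ q₁ q₂) (hgen : Subgroup.closure {q₀, q₁, q₂} = ⊤)
    (hx : extraRelator n s t q₀ q₁ q₂ = 1) :
    2 ^ (s - 2) * 2 ^ (t - 2) * Nat.card Q ≤ Nat.card (H n s t) := by
  have hr := h.realizes hs ht hx
  have hsurj : hr.lift.range = ⊤ := by
    rw [eq_top_iff, ← hgen, Subgroup.closure_le]
    rintro g (rfl | rfl | rfl)
    exacts [⟨_, hr.lift_gen 0⟩, ⟨_, hr.lift_gen 1⟩, ⟨_, hr.lift_gen 2⟩]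
  have hA : (gen n s t 0 * gen n s t 1) ^ 4 ∈ hr.lift.ker := by
    rw [MonoidHom.mem_ker, map_pow, map_mul, hr.lift_gen, hr.lift_gen]; exact h.pow₀₁
  have hB : (gen n s t 1 * gen n s t 2) ^ 4 ∈ hr.lift.ker := by
    rw [MonoidHom.mem_ker, map_pow, map_mul, hr.lift_gen, hr.lift_gen]; exact h.pow₁₂
  have hker : 2 ^ (s - 2) * 2 ^ (t - 2) ≤ Nat.card hr.lift.ker := by
    rw [← orderOf_gen₀₁_pow_four (n := n) hs (by omega : 1 ≤ t),
      ← orderOf_gen₁₂_pow_four (n := n) (by omega : 1 ≤ s) ht, ← Nat.card_zpowers,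
      ← Nat.card_zpowers, ← Nat.card_prod]
    refine Nat.card_le_card_of_injective (fun p => ⟨(p.1 : H n s t) * p.2, mul_mem
      (Subgroup.zpowers_le.2 hA p.1.2) (Subgroup.zpowers_le.2 hB p.2.2)⟩) fun p p' e => ?_
    exact Subgroup.mul_injective_of_disjoint (disjoint_zpowers_pow_four (by omega))
      (Subtype.ext_iff.1 e)
  rw [← Subgroup.card_mul_index hr.lift.ker, Subgroup.index_ker, hsurj, Subgroup.card_top]
  exact Nat.mul_le_mul_right _ hker

end Cardinality

/-! ### Finite models: square tilings on a torus. -/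

section Wreath

open DihedralGroup RegularWreathProduct

variable {m : ℕ}

/-- The wreath product of a dihedral group by a group of order two. -/
abbrev DihedralWreath (m : ℕ) : Type := DihedralGroup m ≀ᵣ Multiplicative (ZMod 2)

/-- The generator of the top group. -/
def flip₂ : Multiplicative (ZMod 2) := Multiplicative.ofAdd 1

lemma eq_one_or_eq_flip₂ (q : Multiplicative (ZMod 2)) : q = 1 ∨ q = flip₂ := by
  revert q; decide

lemma flip₂_ne_one : flip₂ ≠ 1 := by decide

lemma flip₂_mul_self : flip₂ * flip₂ = 1 := by decide

/-- The embedding of the coordinate `q` in the base group. -/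
def coord (q : Multiplicative (ZMod 2)) : DihedralGroup m →* DihedralWreath m where
  toFun x := ⟨Pi.mulSingle q x, 1⟩
  map_one' := by ext <;> simp
  map_mul' x y := by
    refine RegularWreathProduct.ext ?_ (by simp)
    simp [Pi.mulSingle_mul]

lemma inl_flip₂_mul_self : (inl flip₂ * inl flip₂ : DihedralWreath m) = 1 := by
  rw [← map_mul, flip₂_mul_self, map_one]

lemma conj_coord_flip₂ (x : DihedralGroup m) :
    (inl flip₂ * coord flip₂ x * inl flip₂ : DihedralWreath m) = coord 1 x := by
  refine RegularWreathProduct.ext (funext fun q => ?_) (by simp [coord, flip₂_mul_self])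
  have h : flip₂⁻¹ * q = flip₂ ↔ q = 1 := by
    rw [inv_mul_eq_iff_eq_mul, flip₂_mul_self]
  simp [coord, Pi.mulSingle_apply, h]

lemma conj_coord_one (x : DihedralGroup m) :
    (inl flip₂ * coord 1 x * inl flip₂ : DihedralWreath m) = coord flip₂ x := by
  rw [← conj_coord_flip₂]
  simp only [mul_assoc, inl_flip₂_mul_self, mul_one]
  rw [← mul_assoc, inl_flip₂_mul_self, one_mul]

lemma commute_coord (x y : DihedralGroup m) :
    Commute (coord 1 x : DihedralWreath m) (coord flip₂ y) := by
  refine RegularWreathProduct.ext (funext fun q => ?_) (by simp [coord])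
  rcases eq_one_or_eq_flip₂ q with rfl | rfl
  · simp [coord, Pi.mulSingle_apply, flip₂_ne_one.symm]
  · simp [coord, Pi.mulSingle_apply, flip₂_ne_one]

lemma eq_coord_mul_coord_mul_inl (w : DihedralWreath m) :
    w = coord 1 (w.left 1) * coord flip₂ (w.left flip₂) * inl w.right := by
  refine RegularWreathProduct.ext (funext fun q => ?_) (by simp [coord])
  rcases eq_one_or_eq_flip₂ q with rfl | rfl
  · simp [coord, Pi.mulSingle_apply, flip₂_ne_one.symm]
  · simp [coord, Pi.mulSingle_apply, flip₂_ne_one]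

/-- The outer generators reflect one coordinate each and the middle one swaps coordinates. Taking
`sr 0` and `sr 1` makes the translations the unit rotations `r 1` of the coordinates. -/
lemma wreath_squareRelations (m : ℕ) :
    SquareRelations (coord 1 (sr 0) : DihedralWreath m) (inl flip₂) (coord flip₂ (sr 1)) where
  mul_self₀ := by rw [← map_mul, sr_mul_self, map_one]
  mul_self₁ := inl_flip₂_mul_self
  mul_self₂ := by rw [← map_mul, sr_mul_self, map_one]
  commute₀₂ := commute_coord _ _
  pow₀₁ := by
    have e : (coord 1 (sr 0) * inl flip₂ : DihedralWreath m) ^ 2 =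
        coord 1 (sr 0) * coord flip₂ (sr 0) := by
      rw [← conj_coord_one]; simp [pow_two, mul_assoc]
    rw [show (4 : ℕ) = 2 * 2 from rfl, pow_mul, e, (commute_coord _ _).mul_pow, ← map_pow,
      ← map_pow, pow_two, sr_mul_self, map_one, map_one, one_mul]
  pow₁₂ := by
    have e : (inl flip₂ * coord flip₂ (sr 1) : DihedralWreath m) ^ 2 =
        coord 1 (sr 1) * coord flip₂ (sr 1) := by
      rw [← conj_coord_flip₂]; simp [pow_two, mul_assoc]
    rw [show (4 : ℕ) = 2 * 2 from rfl, pow_mul, e, (commute_coord _ _).mul_pow, ← map_pow,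
      ← map_pow, pow_two, sr_mul_self, map_one, map_one, one_mul]

lemma wreath_trX (m : ℕ) : SquareRelations.trX (coord 1 (sr 0) : DihedralWreath m) (inl flip₂)
    (coord flip₂ (sr 1)) = coord 1 (r 1) := by
  rw [SquareRelations.trX, conj_coord_flip₂, ← map_mul, sr_mul_sr, sub_zero]

lemma wreath_trY (m : ℕ) : SquareRelations.trY (coord 1 (sr 0) : DihedralWreath m) (inl flip₂)
    (coord flip₂ (sr 1)) = coord flip₂ (r 1) := by
  rw [SquareRelations.trY, conj_coord_one, ← map_mul, sr_mul_sr, sub_zero]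

lemma closure_wreath (m : ℕ) : Subgroup.closure
    {(coord 1 (sr 0) : DihedralWreath m), inl flip₂, coord flip₂ (sr 1)} = ⊤ := by
  set S := Subgroup.closure {(coord 1 (sr 0) : DihedralWreath m), inl flip₂, coord flip₂ (sr 1)}
  have h0 : coord 1 (sr 0) ∈ S := Subgroup.subset_closure (by simp)
  have h1 : inl flip₂ ∈ S := Subgroup.subset_closure (by simp)
  have h2 : coord flip₂ (sr 1) ∈ S := Subgroup.subset_closure (by simp)
  have hr : coord 1 (r 1) ∈ S := by
    rw [← wreath_trX]
    exact mul_mem h0 (mul_mem (mul_mem h1 h2) h1)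
  have hri (i : ZMod m) : coord 1 (r i) ∈ S := by
    obtain ⟨k, rfl⟩ := ZMod.intCast_surjective i
    rw [← r_one_zpow, map_zpow]
    exact zpow_mem hr k
  have hone (x : DihedralGroup m) : coord 1 x ∈ S := by
    cases x with
    | r i => exact hri i
    | sr i =>
      have e : (sr i : DihedralGroup m) = sr 0 * r i := by rw [sr_mul_r, zero_add]
      rw [e, map_mul]
      exact mul_mem h0 (hri i)
  have hflip (x : DihedralGroup m) : coord flip₂ x ∈ S := by
    rw [← conj_coord_one]
    exact mul_mem (mul_mem h1 (hone x)) h1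
  refine eq_top_iff.2 fun w _ => ?_
  rw [eq_coord_mul_coord_mul_inl w]
  refine mul_mem (mul_mem (hone _) (hflip _)) ?_
  rcases eq_one_or_eq_flip₂ w.right with h | h <;> rw [h]
  · rw [map_one]; exact one_mem _
  · exact h1

lemma card_dihedralWreath (m : ℕ) : Nat.card (DihedralWreath m) = 8 * (m * m) := by
  rw [RegularWreathProduct.card, DihedralGroup.nat_card, Nat.card_eq_fintype_card,
    Fintype.card_multiplicative, ZMod.card]
  ring

/-- The half-turn of both coordinates. -/
def halfTurn (m : ℕ) : DihedralWreath (2 * m) := coord 1 (r m) * coord flip₂ (r m)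

lemma natCast_add_self (m : ℕ) : (m : ZMod (2 * m)) + m = 0 := by
  have := ZMod.natCast_self (2 * m)
  rwa [two_mul m, Nat.cast_add, ← two_mul m] at this

lemma commute_half (m : ℕ) (x : DihedralGroup (2 * m)) : Commute x (r m) := by
  cases x with
  | r i => rw [Commute, SemiconjBy, r_mul_r, r_mul_r, add_comm]
  | sr i =>
    rw [Commute, SemiconjBy, sr_mul_r, r_mul_sr, sub_eq_add_neg,
      neg_eq_of_add_eq_zero_left (natCast_add_self m)]

/-- Modulo `2 * m` the vector `(m, m)` is fixed by sign changes and by the swap. Hence it may be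
factored out at the cost of only a factor 2. -/
lemma commute_halfTurn (w : DihedralWreath (2 * m)) : Commute w (halfTurn m) := by
  have hone (x : DihedralGroup (2 * m)) : Commute (coord 1 x) (halfTurn m) :=
    ((commute_half m x).map (coord 1)).mul_right (commute_coord _ _)
  have hflip (x : DihedralGroup (2 * m)) : Commute (coord flip₂ x) (halfTurn m) :=
    (commute_coord _ _).symm.mul_right ((commute_half m x).map (coord flip₂))
  have hinl : Commute (inl flip₂) (halfTurn m) := by
    have e : (inl flip₂ : DihedralWreath (2 * m)) * halfTurn m * inl flip₂ = halfTurn m := by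
      calc _ = inl flip₂ * coord 1 (r m) * inl flip₂ * (inl flip₂ * coord flip₂ (r m) *
            inl flip₂ : DihedralWreath (2 * m)) := by
            simp only [halfTurn, mul_assoc]
            rw [← mul_assoc (inl flip₂) (inl flip₂), inl_flip₂_mul_self, one_mul]
        _ = halfTurn m := by
            rw [conj_coord_one, conj_coord_flip₂, ← (commute_coord _ _).eq, halfTurn]
    calc inl flip₂ * halfTurn m = inl flip₂ * halfTurn m * inl flip₂ * inl flip₂ := by
          rw [mul_assoc _ (inl flip₂), inl_flip₂_mul_self, mul_one]
      _ = halfTurn m * inl flip₂ := by rw [e]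
  rw [eq_coord_mul_coord_mul_inl w]
  refine ((hone _).mul_left (hflip _)).mul_left ?_
  rcases eq_one_or_eq_flip₂ w.right with h | h <;> rw [h]
  · rw [map_one]; exact Commute.one_left _
  · exact hinl

lemma orderOf_halfTurn (hm : 0 < m) : orderOf (halfTurn m) = 2 := by
  refine orderOf_eq_prime ?_ fun h => ?_
  · rw [halfTurn, (commute_coord _ _).mul_pow, ← map_pow, ← map_pow, pow_two, r_mul_r,
      natCast_add_self, r_zero, map_one, map_one, one_mul]
  · have h1 := congrFun (congrArg RegularWreathProduct.left h) 1
    have h2 : (r (m : ZMod (2 * m)) : DihedralGroup (2 * m)) = 1 := by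
      simpa [halfTurn, coord, Pi.mulSingle_apply, flip₂_ne_one.symm] using h1
    have h3 := (ZMod.natCast_eq_zero_iff m (2 * m)).1 (r.inj (h2.trans one_def))
    have := Nat.le_of_dvd hm h3
    omega

instance halfTurn_normal (m : ℕ) : (Subgroup.zpowers (halfTurn m)).Normal := by
  refine ⟨fun x hx g => ?_⟩
  obtain ⟨k, rfl⟩ := hx
  have := (commute_halfTurn g).zpow_right k
  simp only [this.eq, mul_inv_cancel_right]
  exact ⟨k, rfl⟩

lemma card_quotient_halfTurn (hm : 0 < m) :
    Nat.card (DihedralWreath (2 * m) ⧸ Subgroup.zpowers (halfTurn m)) = 8 * (2 * m * m) := by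
  have h := Subgroup.card_eq_card_quotient_mul_card_subgroup (Subgroup.zpowers (halfTurn m))
  rw [Nat.card_zpowers, orderOf_halfTurn hm, card_dihedralWreath] at h
  linarith

end Wreath

/-! ### The order of `H` in both parities. -/

section Main

open DihedralGroup RegularWreathProduct SquareRelations

variable {s t : ℕ}

lemma SquareRelations.extraRelator_odd {G : Type*} [Group G] {a b c : G}
    (h : SquareRelations a b c) (k : ℕ) :
    extraRelator (s + t + 1 + 2 * k) s t a b c = trY a b c ^ 2 ^ (k + 1) := by
  rw [StringC.extraRelator_odd, h.comm_sq_right, ← pow_mul, pow_succ']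

lemma SquareRelations.extraRelator_even {G : Type*} [Group G] {a b c : G}
    (h : SquareRelations a b c) (k : ℕ) :
    extraRelator (s + t + 2 + 2 * k) s t a b c =
      trX a b c ^ 2 ^ (k + 1) * trY a b c ^ 2 ^ (k + 1) := by
  rw [StringC.extraRelator_even, h.comm_sq_sq, (h.commute_tr.pow_pow 2 2).mul_pow, ← pow_mul,
    ← pow_mul, pow_succ']

lemma card_H_odd (hs : 2 ≤ s) (ht : 2 ≤ t) (k : ℕ) :
    Nat.card (H (s + t + 1 + 2 * k) s t) = 2 ^ (s + t + 1 + 2 * k) := by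
  have hpos : 0 < 2 ^ (k + 1) := by positivity
  -- Exponents: `(s - 2) + (t - 2) + 3 + 2 * (k + 1) = s + t + 1 + 2 * k`.
  have harith : 2 ^ (s - 2) * 2 ^ (t - 2) * (8 * (2 ^ (k + 1) * 2 ^ (k + 1))) =
      2 ^ (s + t + 1 + 2 * k) := by
    rw [show 8 = 2 ^ 3 by norm_num, ← pow_add, ← pow_add, ← pow_add, ← pow_add]
    congr 1
    omega
  obtain ⟨hf, hle⟩ := finite_H_of_square_bound (n := s + t + 1 + 2 * k) hs ht
    (b := 8 * (2 ^ (k + 1) * 2 ^ (k + 1))) fun Q _ q₀ q₁ q₂ hq hgen hx =>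
      hq.finite_of_trY_pow hgen hpos (by rwa [hq.extraRelator_odd] at hx)
  have hge := le_card_H (n := s + t + 1 + 2 * k) hs ht (wreath_squareRelations (2 ^ (k + 1)))
    (closure_wreath _) (by
      rw [(wreath_squareRelations _).extraRelator_odd, wreath_trY, ← map_pow, r_one_pow_n,
        map_one])
  rw [card_dihedralWreath, harith] at hge
  rw [harith] at hle
  exact le_antisymm hle hge

lemma card_H_even (hs : 2 ≤ s) (ht : 2 ≤ t) (k : ℕ) :
    Nat.card (H (s + t + 2 + 2 * k) s t) = 2 ^ (s + t + 2 + 2 * k) := by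
  have hpos : 0 < 2 ^ (k + 1) := by positivity
  have harith : 2 ^ (s - 2) * 2 ^ (t - 2) * (8 * (2 * 2 ^ (k + 1) * 2 ^ (k + 1))) =
      2 ^ (s + t + 2 + 2 * k) := by
    rw [show 8 = 2 ^ 3 by norm_num, ← pow_succ', ← pow_add, ← pow_add, ← pow_add, ← pow_add]
    congr 1
    omega
  obtain ⟨hf, hle⟩ := finite_H_of_square_bound (n := s + t + 2 + 2 * k) hs ht
    (b := 8 * (2 * 2 ^ (k + 1) * 2 ^ (k + 1))) fun Q _ q₀ q₁ q₂ hq hgen hx =>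
      hq.finite_of_trX_pow_mul_trY_pow hgen hpos (by rwa [hq.extraRelator_even] at hx)
  -- The modulus is `2m` with `m = 2 ^ (k + 1)`, so that the relator `(m, m)` is the half-turn,
  -- trivial in the quotient.
  have hw := wreath_squareRelations (2 * 2 ^ (k + 1))
  set p := QuotientGroup.mk' (Subgroup.zpowers (halfTurn (2 ^ (k + 1))))
  have hge := le_card_H (n := s + t + 2 + 2 * k) hs ht (hw.map p)
    (by
      have := congrArg (Subgroup.map p) (closure_wreath (2 * 2 ^ (k + 1)))
      rwa [MonoidHom.map_closure, Set.image_insert_eq, Set.image_pair,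
        Subgroup.map_top_of_surjective _ (QuotientGroup.mk'_surjective _)] at this)
    (by
      rw [← map_extraRelator, hw.extraRelator_even, wreath_trX, wreath_trY, ← map_pow, ← map_pow,
        r_one_pow]
      exact (QuotientGroup.eq_one_iff _).2 (Subgroup.mem_zpowers _))
  rw [card_quotient_halfTurn hpos, harith] at hge
  rw [harith] at hle
  exact le_antisymm hle hge

end Main

end StringC

theorem theorem1p2 (n s t : ℕ) (hn : 10 ≤ n) (hs : 2 ≤ s) (ht : 2 ≤ t) (hst : s + t ≤ n - 1) :
    StringC.IsStringCGroup (StringC.gen n s t) ∧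
      Nat.card (StringC.H n s t) = 2 ^ n ∧
      StringC.HasSchlafliType (StringC.gen n s t) ![2 ^ s, 2 ^ t] := by
  have hs1 : 1 ≤ s := by omega
  have ht1 : 1 ≤ t := by omega
  refine ⟨⟨StringC.orderOf_gen hs1 ht1, StringC.closure_range_gen n s t, fun i j hij => ?_,
    StringC.gen_intersection hs1 ht1⟩, ?_, fun i => ?_⟩
  · obtain rfl : i = 0 := by ext; simp; omega
    obtain rfl : j = 2 := by ext; simp at hij ⊢; omega
    exact (StringC.gen_realizes n s t).commute₀₂
  · obtain ⟨d, hd⟩ := Nat.exists_eq_add_of_le (show s + t + 1 ≤ n by omega)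
    -- Here `d = n - s - t - 1`, so even `d` is the odd case of the relator.
    obtain ⟨k, rfl | rfl⟩ := Nat.even_or_odd' d
    · rw [hd]; exact StringC.card_H_odd hs ht k
    · obtain rfl : n = s + t + 2 + 2 * k := by omega
      exact StringC.card_H_even hs ht k
  · fin_cases i
    · exact StringC.orderOf_gen₀₁ ht1
    · exact StringC.orderOf_gen₁₂ hs1
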